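/- Let $X$ and $U$ be real Hilbert spaces, let $B\colon U\to X$ be bounded and linear, and let $M\colon X\supset D(M)\to X$ be a (nonlinear, possibly unbounded, single-valued) maximal monotone operator, i.e. $\langle M(x)-M(z),x-z\rangle_X\ge 0$ for all $x,z\in D(M)$ and the graph of $M$ has no proper monotone extension in $X\times X$. Let $F\subset U$ be closed and convex, and let $(x^\star,u^\star)\in D(M)\times\operatorname{int}F$ be a controlled equilibrium, i.e. $M(x^\star)=Bu^\star$. Let $P_F$ be the orthogonal projection onto $F$ and let $$M_{\mathrm{cl}}(x)=M(x)-BP_F\bigl(u^\star-B^*(x-x^\star)\bigr),\qquad D(M_{\mathrm{cl}})=D(M).$$ For a maximal monotone operator $W$ on $X$, the semigroup generated by $-W$ is $$S(t)x_0=\lim_{n\to\infty}\bigl(I+\tfrac tn W\bigr)^{-n}x_0,\qquad t\ge 0,\ x_0\in\overline{D(W)}.$$ If $(x,u)\in D(W)\times U$ satisfies $W(x)=Bu$, we say that $(W,B)$ is *detectable at the controlled equilibrium* $(x,u)$ if, $S$ denoting the semigroup generated by $-(W-Bu)$ (the flow of $\dot z=-W(z)+Bu$ under the constant equilibrium input $u$),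 one has $\lim_{t\to\infty}S(t)x_0=x$ for every $x_0$ in the unobservable set $$\bigcap_{t\ge 0}\bigl\{x_0\in D(W): B^*S(s)x_0=B^*x\ \text{ for all } s\in[0,t]\bigr\}.$$ Then $(M,B)$ is detectable at the controlled equilibrium $(x^\star,u^\star)$ if and only if $(M_{\mathrm{cl}},B)$ is detectable at its controlled equilibrium $(x^\star,0)$, where for the closed loop $S$ is the semigroup generated by $-M_{\mathrm{cl}}$. -/

import Mathlib

open Filter Topology Set
open scoped InnerProductSpace

namespace MonotoneControl

variable {X U : Type*}
  [NormedAddCommGroup X] [InnerProductSpace ℝ X] [CompleteSpace X]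
  [NormedAddCommGroup U] [InnerProductSpace ℝ U] [CompleteSpace U]

/-- A subset `G` of `X × X` (the graph of a possibly multivalued operator) is monotone if
`⟪v - w, x - z⟫ ≥ 0` for all `(x, v), (z, w) ∈ G`. -/
def IsMonotoneGraph (G : Set (X × X)) : Prop :=
  ∀ p ∈ G, ∀ q ∈ G, 0 ≤ ⟪p.2 - q.2, p.1 - q.1⟫_ℝ

/-- A (nonlinear, partially defined, single-valued) operator `M : X ⊃ D(M) → X` is maximal
monotone if its graph is monotone and has no proper monotone extension. Extensions may be
multivalued, as is standard. -/
def IsMaximalMonotone (M : X →. X) : Prop :=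
  Maximal IsMonotoneGraph M.graph

/-- The operator `x ↦ M x + K x` with domain `D(M)`, for an everywhere defined map `K`. -/
def addMap (M : X →. X) (K : X → X) : X →. X :=
  fun x => (M x).map (fun v => v + K x)

open Classical in
/-- The resolvent `(I + r M)⁻¹ x`: the point `y ∈ D(M)` with `y + r M y = x`. For `M` maximal
monotone and `r > 0` it exists and is unique. If there is no such `y` the value is `x`; for
maximal monotone `M` and `r ≥ 0` this only concerns `r = 0`, where the resolvent thus is the
identity on all of `X`. -/
noncomputable def nlResolvent (M : X →. X) (r : ℝ) (x : X) : X :=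
  if h : ∃ y : X, ∃ v ∈ M y, y + r • v = x then h.choose else x

/-- `S` is the semigroup generated by `-M`: for every `x₀` in the closure of `D(M)` and every
`t ≥ 0`, `S t x₀ = lim_{n → ∞} (I + (t / n) M)⁻ⁿ x₀`, the limit being required to exist.
The values of `S` at other arguments are irrelevant. -/
def IsGeneratedBy (S : ℝ → X → X) (M : X →. X) : Prop :=
  ∀ x₀ ∈ closure M.Dom, ∀ t : ℝ, 0 ≤ t →
    Tendsto (fun n : ℕ => (nlResolvent M (t / n))^[n] x₀) atTop (𝓝 (S t x₀))

/-- `(x, u)` is a controlled equilibrium of `x' = -M x + B u`: `x ∈ D(M)` and `M x = B u`. -/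
def IsControlledEquilibrium (M : X →. X) (B : U →L[ℝ] X) (x : X) (u : U) : Prop :=
  B u ∈ M x

/-- The initial states in `D` that are unobservable on `[0, t]` at `x`, where `S` is the flow:
`B* S(s) x₀ = B* x` for all `s ∈ [0, t]`. -/
def unobservableOn (D : Set X) (S : ℝ → X → X) (B : U →L[ℝ] X) (x : X) (t : ℝ) : Set X :=
  {x₀ | x₀ ∈ D ∧ ∀ s ∈ Icc (0 : ℝ) t,
    ContinuousLinearMap.adjoint B (S s x₀) = ContinuousLinearMap.adjoint B x}

/-- The unobservable set at `x`: the intersection over `t ≥ 0` of the sets of states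
unobservable on `[0, t]`. -/
def unobservableSet (D : Set X) (S : ℝ → X → X) (B : U →L[ℝ] X) (x : X) : Set X :=
  ⋂ t ∈ Ici (0 : ℝ), unobservableOn D S B x t

/-- Detectability of `x' = -M x + B u`, `y = B* x` at the controlled equilibrium `(x, u)`.
The flow `S` is that of the system under the constant equilibrium input `u`, i.e. the semigroup
generated by `-(M - B u)`, for which `x` is a fixed point; all states in the unobservable set
have to be steered to `x` by it. For `u = 0` the semigroup is the one generated by `-M`. -/
def IsDetectableAt (M : X →. X) (B : U →L[ℝ] X) (x : X) (u : U) : Prop :=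
  ∃ S : ℝ → X → X, IsGeneratedBy S (addMap M fun _ => -B u) ∧
    ∀ x₀ ∈ unobservableSet M.Dom S B x, Tendsto (fun t => S t x₀) atTop (𝓝 x)

/-- The metric projection onto `F`: a point of `F` closest to `u`. It exists and is unique if
`F` is nonempty, closed and convex. -/
noncomputable def proj (F : Set U) (u : U) : U :=
  Classical.epsilon fun p => p ∈ F ∧ ∀ q ∈ F, ‖u - p‖ ≤ ‖u - q‖

/-- For nonempty closed convex `F`, the projection has its defining property. -/
theorem proj_spec {F : Set U} (hne : F.Nonempty) (hcl : IsClosed F) (hc : Convex ℝ F) (u : U) :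
    proj F u ∈ F ∧ ∀ q ∈ F, ‖u - proj F u‖ ≤ ‖u - q‖ := by
  refine Classical.epsilon_spec (p := fun p => p ∈ F ∧ ∀ q ∈ F, ‖u - p‖ ≤ ‖u - q‖) ?_
  obtain ⟨p, hp, h⟩ := exists_norm_eq_iInf_of_complete_convex hne hcl.isComplete hc u
  refine ⟨p, hp, fun q hq => ?_⟩
  rw [h]
  exact ciInf_le ⟨0, by rintro _ ⟨w, rfl⟩; exact norm_nonneg _⟩ (⟨q, hq⟩ : F)

/-- The closed-loop operator `M_cl x = M x - B P_F (u⋆ - B* (x - x⋆))` with domain `D(M)`. -/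
noncomputable def closedLoop (M : X →. X) (B : U →L[ℝ] X) (F : Set U) (x' : X) (u' : U) :
    X →. X :=
  addMap M fun x => -B (proj F (u' - ContinuousLinearMap.adjoint B (x - x')))

end MonotoneControl

/-! Along an unobservable trajectory the output is constantly `B* x⋆`, so the feedback sees `u⋆ -
B*(S(t)x₀ - x⋆) = u⋆`, which `P_F` fixes. Open and closed loop thus agree there, and the two flows
should share all their unobservable trajectories.

Since flows are given only by the exponential formula, this is proved on resolvent iterates
(`IsGeneratedBy.eq_of_eq_along`). With step `t/n` they stay within `O(1/√n)` of the flow, so a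
Lipschitz difference of the perturbations is `O(1/√n)` on them. Over `n` steps the error is at most
`n · (t/n) · O(1/√n) → 0`.

Detectability also asserts that the semigroup exists. Minty's theorem gives the resolvents of `M`, a
contraction argument those of its Lipschitz perturbations for small steps, and an estimate of
Crandall–Liggett type gives convergence. Monotonicity of the feedback comes from that of `P_F`. -/

namespace MonotoneControl

/-! ### Minty's theorem via the Fitzpatrick function -/

section Minty

theorem cauchySeq_of_norm_sq_le {X : Type*} [NormedAddCommGroup X] {f : ℕ → X} {e : ℕ → ℝ}
    (he : Tendsto e atTop (𝓝 0))
    (h : ∀ᶠ N in atTop, ∀ n ≥ N, ∀ m ≥ N, ‖f n - f m‖ ^ 2 ≤ e n + e m) : CauchySeq f := by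
  obtain ⟨N₀, h₀⟩ := h.exists
  rw [Metric.cauchySeq_iff]
  intro ε hε
  have h₁ : ∀ᶠ n in atTop, e n < ε ^ 2 / 2 := he.eventually_lt_const (by positivity)
  obtain ⟨N₁, h₁⟩ := eventually_atTop.1 h₁
  refine ⟨max N₀ N₁, fun m hm n hn => ?_⟩
  rw [dist_eq_norm]
  have a := h₀ m ((le_max_left _ _).trans hm) n ((le_max_left _ _).trans hn)
  have b := h₁ m ((le_max_right _ _).trans hm)
  have c := h₁ n ((le_max_right _ _).trans hn)
  exact lt_of_pow_lt_pow_left₀ 2 hε.le (by linarith)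

variable {X : Type*} [NormedAddCommGroup X] [InnerProductSpace ℝ X]

theorem mem_of_forall_monotone {G : Set (X × X)} (hG : Maximal IsMonotoneGraph G) {p : X × X}
    (h : ∀ q ∈ G, 0 ≤ ⟪p.2 - q.2, p.1 - q.1⟫_ℝ) : p ∈ G := by
  refine hG.le_of_ge (y := insert p G) ?_ (subset_insert _ _) (mem_insert _ _)
  rintro a (rfl | ha) b (rfl | hb)
  · simp
  · exact h b hb
  · rw [← neg_sub, ← neg_sub b.1, inner_neg_neg]
    exact h a ha
  · exact hG.prop a ha b hb

/-- The epigraph of the Fitzpatrick function of `G`. -/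
def fitzpatrickEpigraph (G : Set (X × X)) : Set ((X × X) × ℝ) :=
  {p | ∀ q ∈ G, ⟪p.1.1, q.2⟫_ℝ + ⟪q.1, p.1.2⟫_ℝ - ⟪q.1, q.2⟫_ℝ ≤ p.2}

theorem convex_fitzpatrickEpigraph (G : Set (X × X)) : Convex ℝ (fitzpatrickEpigraph G) := by
  intro p hp q hq a b ha hb hab r hr
  have h₁ := mul_le_mul_of_nonneg_left (hp r hr) ha
  have h₂ := mul_le_mul_of_nonneg_left (hq r hr) hb
  simp only [Prod.fst_add, Prod.snd_add, Prod.smul_fst, Prod.smul_snd, inner_add_left,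
    inner_add_right, real_inner_smul_left, real_inner_smul_right, smul_eq_mul]
  have : ⟪r.1, r.2⟫_ℝ = a * ⟪r.1, r.2⟫_ℝ + b * ⟪r.1, r.2⟫_ℝ := by rw [← add_mul, hab, one_mul]
  linarith

theorem isClosed_fitzpatrickEpigraph (G : Set (X × X)) : IsClosed (fitzpatrickEpigraph G) := by
  have : fitzpatrickEpigraph G =
      ⋂ q ∈ G, {p | ⟪p.1.1, q.2⟫_ℝ + ⟪q.1, p.1.2⟫_ℝ - ⟪q.1, q.2⟫_ℝ ≤ p.2} := by
    ext p
    simp [fitzpatrickEpigraph]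
  rw [this]
  exact isClosed_biInter fun q _ => isClosed_le (by fun_prop) (by fun_prop)

/-- If the inequality failed, `p.1` would be monotonically related to all of `G`, hence in `G` by
maximality; testing the epigraph condition at `p.1` itself is then a contradiction. -/
theorem inner_le_of_mem_fitzpatrickEpigraph {G : Set (X × X)} (hG : Maximal IsMonotoneGraph G)
    {p : (X × X) × ℝ} (hp : p ∈ fitzpatrickEpigraph G) : ⟪p.1.1, p.1.2⟫_ℝ ≤ p.2 := by
  by_contra! hlt
  have hmem : p.1 ∈ G := mem_of_forall_monotone hG fun q hq => by
    have := hp q hq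
    rw [real_inner_comm] at hlt
    simp only [inner_sub_left, inner_sub_right]
    rw [real_inner_comm p.1.1 q.2, real_inner_comm q.1 p.1.2, real_inner_comm q.1 q.2] at *
    linarith
  have := hp p.1 hmem
  linarith

theorem mk_inner_mem_fitzpatrickEpigraph {G : Set (X × X)} (hG : IsMonotoneGraph G)
    {p : X × X} (hp : p ∈ G) : (p, ⟪p.1, p.2⟫_ℝ) ∈ fitzpatrickEpigraph G := by
  intro q hq
  have := hG p hp q hq
  simp only [inner_sub_left, inner_sub_right] at this ⊢
  rw [real_inner_comm p.1 p.2, real_inner_comm p.1 q.2, real_inner_comm q.1 p.2,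
    real_inner_comm q.1 q.2] at this
  linarith

/-- The function `(x, v, t) ↦ t + (‖x‖² + ‖v‖²) / 2`. -/
noncomputable def regularized (p : (X × X) × ℝ) : ℝ :=
  p.2 + (‖p.1.1‖ ^ 2 + ‖p.1.2‖ ^ 2) / 2

/-- The midpoint of two near-minimizers lies in `E`, so the parallelogram law makes the `X × X`
components of a minimizing sequence Cauchy. The real component converges because the values do. -/
theorem exists_isMinOn_regularized [CompleteSpace X] {E : Set ((X × X) × ℝ)} (hne : E.Nonempty)
    (hcl : IsClosed E) (hc : Convex ℝ E) (hb : BddBelow (regularized '' E)) :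
    ∃ p ∈ E, IsMinOn regularized E p := by
  set m := sInf (regularized '' E) with hm
  have hle : ∀ p ∈ E, m ≤ regularized p := fun p hp => csInf_le hb (mem_image_of_mem _ hp)
  have hex : ∀ n : ℕ, ∃ p ∈ E, regularized p < m + 1 / ((n : ℝ) + 1) := fun n => by
    obtain ⟨_, ⟨p, hp, rfl⟩, h⟩ := exists_lt_of_csInf_lt (hne.image regularized)
      (lt_add_of_pos_right m (Nat.one_div_pos_of_nat (α := ℝ) (n := n)))
    exact ⟨p, hp, h⟩
  choose p hpE hp using hex
  have he : Tendsto (fun n : ℕ => 1 / ((n : ℝ) + 1)) atTop (𝓝 0) :=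
    tendsto_one_div_add_atTop_nhds_zero_nat
  have key : ∀ k l, ‖(p k).1.1 - (p l).1.1‖ ^ 2 + ‖(p k).1.2 - (p l).1.2‖ ^ 2 ≤
      4 * (1 / ((k : ℝ) + 1)) + 4 * (1 / ((l : ℝ) + 1)) := fun k l => by
    have h := hle _ (hc (hpE k) (hpE l) (a := 1 / 2) (b := 1 / 2) (by norm_num) (by norm_num)
      (by norm_num))
    have h₁ := hp k
    have h₂ := hp l
    simp only [regularized, Prod.fst_add, Prod.snd_add, Prod.smul_fst, Prod.smul_snd,
      ← smul_add, norm_smul, mul_pow, smul_eq_mul] at h h₁ h₂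
    have e₁ := parallelogram_law_with_norm ℝ (p k).1.1 (p l).1.1
    have e₂ := parallelogram_law_with_norm ℝ (p k).1.2 (p l).1.2
    norm_num at h
    norm_num at h₁ h₂ ⊢
    linarith
  have he4 : Tendsto (fun n : ℕ => 4 * (1 / ((n : ℝ) + 1))) atTop (𝓝 0) := by
    simpa using he.const_mul 4
  obtain ⟨x, hx⟩ := cauchySeq_tendsto_of_complete (cauchySeq_of_norm_sq_le
    (f := fun n => (p n).1.1) he4 (Eventually.of_forall fun N k _ l _ => by
      have := key k l
      have := sq_nonneg ‖(p k).1.2 - (p l).1.2‖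
      linarith))
  obtain ⟨v, hv⟩ := cauchySeq_tendsto_of_complete (cauchySeq_of_norm_sq_le
    (f := fun n => (p n).1.2) he4 (Eventually.of_forall fun N k _ l _ => by
      have := key k l
      have := sq_nonneg ‖(p k).1.1 - (p l).1.1‖
      linarith))
  have hval : Tendsto (fun n => regularized (p n)) atTop (𝓝 m) :=
    tendsto_of_tendsto_of_tendsto_of_le_of_le tendsto_const_nhds
      (by simpa using he.const_add m) (fun n => hle _ (hpE n)) fun n => (hp n).le
  have hsq := ((hx.norm.pow 2).add (hv.norm.pow 2)).div_const 2
  have ht : Tendsto (fun n => (p n).2) atTop (𝓝 (m - (‖x‖ ^ 2 + ‖v‖ ^ 2) / 2)) := by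
    refine (hval.sub hsq).congr fun n => ?_
    simp [regularized]
  refine ⟨((x, v), m - (‖x‖ ^ 2 + ‖v‖ ^ 2) / 2),
    hcl.mem_of_tendsto ((hx.prodMk_nhds hv).prodMk_nhds ht) (Eventually.of_forall hpE),
    fun q hq => ?_⟩
  have := hle q hq
  simp only [mem_ofPred_eq]
  refine le_trans (le_of_eq ?_) this
  simp [regularized]

/-- First-order optimality: compare with the segment from `p` to `q`, divide by `s` and let `s → 0`.
-/
theorem IsMinOn.le_regularized {E : Set ((X × X) × ℝ)} (hc : Convex ℝ E) {p q : (X × X) × ℝ}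
    (hp : p ∈ E) (hmin : IsMinOn regularized E p) (hq : q ∈ E) :
    0 ≤ q.2 - p.2 + ⟪p.1.1, q.1.1 - p.1.1⟫_ℝ + ⟪p.1.2, q.1.2 - p.1.2⟫_ℝ := by
  set a := q.2 - p.2 + ⟪p.1.1, q.1.1 - p.1.1⟫_ℝ + ⟪p.1.2, q.1.2 - p.1.2⟫_ℝ with ha
  set b := (‖q.1.1 - p.1.1‖ ^ 2 + ‖q.1.2 - p.1.2‖ ^ 2) / 2 with hb
  have h : ∀ s ∈ Ioc (0 : ℝ) 1, 0 ≤ a + s * b := fun s hs => by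
    have h := hmin (hc.add_smul_sub_mem hp hq ⟨hs.1.le, hs.2⟩)
    simp only [mem_ofPred_eq, regularized, Prod.fst_add, Prod.snd_add, Prod.smul_fst, Prod.smul_snd,
      Prod.fst_sub, Prod.snd_sub, smul_eq_mul, norm_add_sq_real, real_inner_smul_right, norm_smul,
      mul_pow, Real.norm_eq_abs, sq_abs] at h
    refine nonneg_of_mul_nonneg_right (a := s) ?_ hs.1
    rw [ha, hb]
    linarith
  have hlim : Tendsto (fun s : ℝ => a + s * b) (𝓝[>] 0) (𝓝 (a + 0 * b)) :=
    ((continuous_const.add (continuous_id.mul continuous_const)).tendsto 0).mono_left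
      nhdsWithin_le_nhds
  rw [zero_mul, add_zero] at hlim
  refine ge_of_tendsto hlim ?_
  filter_upwards [Ioc_mem_nhdsGT (zero_lt_one' ℝ)] with s hs using h s hs

/-- For a minimizer `((a, b), t)`, optimality at graph points together with `⟪a, b⟫ ≤ t` puts `(-b,
-a)` in `G`. Testing the same inequality at this point forces `a + b = 0`. -/
theorem exists_mk_neg_mem [CompleteSpace X] {G : Set (X × X)}
    (hG : Maximal IsMonotoneGraph G) : ∃ x, (x, -x) ∈ G := by
  have hne : G.Nonempty := by
    by_contra h
    rw [not_nonempty_iff_eq_empty] at h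
    have : (0 : X × X) ∈ G := mem_of_forall_monotone hG (by simp [h])
    simp [h] at this
  obtain ⟨g, hg⟩ := hne
  obtain ⟨p, hp, hmin⟩ := exists_isMinOn_regularized
    ⟨_, mk_inner_mem_fitzpatrickEpigraph hG.prop hg⟩
    (isClosed_fitzpatrickEpigraph G) (convex_fitzpatrickEpigraph G) ⟨0, by
      rintro _ ⟨p, hp, rfl⟩
      have h₁ := inner_le_of_mem_fitzpatrickEpigraph hG hp
      have h₂ := norm_add_sq_real p.1.1 p.1.2
      have h₃ := sq_nonneg ‖p.1.1 + p.1.2‖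
      rw [regularized]
      linarith⟩
  have hle := inner_le_of_mem_fitzpatrickEpigraph hG hp
  have key : ∀ q ∈ G, ‖p.1.1 + p.1.2‖ ^ 2 ≤ ⟪-p.1.1 - q.2, -p.1.2 - q.1⟫_ℝ := fun q hq => by
    have h := IsMinOn.le_regularized (convex_fitzpatrickEpigraph G) hp hmin
      (mk_inner_mem_fitzpatrickEpigraph hG.prop hq)
    have h₂ := norm_add_sq_real p.1.1 p.1.2
    simp only [inner_sub_left, inner_sub_right, inner_neg_left, inner_neg_right,
      real_inner_self_eq_norm_sq] at h ⊢
    rw [real_inner_comm p.1.2 q.2, real_inner_comm q.1 q.2]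
    linarith
  have hmem : ((-p.1.2, -p.1.1) : X × X) ∈ G :=
    mem_of_forall_monotone hG fun q hq => (sq_nonneg _).trans (key q hq)
  have h0 := key _ hmem
  simp only [sub_self, inner_zero_left] at h0
  have h1 : p.1.1 + p.1.2 = 0 := by
    rw [← norm_eq_zero]
    exact pow_eq_zero_iff two_ne_zero |>.1 (le_antisymm h0 (sq_nonneg _))
  refine ⟨-p.1.2, ?_⟩
  rw [neg_neg]
  rwa [← eq_neg_of_add_eq_zero_right h1] at hmem

/-- Minty's theorem. -/
theorem exists_add_smul_eq [CompleteSpace X] {G : Set (X × X)}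
    (hG : Maximal IsMonotoneGraph G) {r : ℝ} (hr : 0 < r) (z : X) :
    ∃ p ∈ G, p.1 + r • p.2 = z := by
  -- Chosen so that `(x, -x) ∈ T ⁻¹' G` says `(x + z, -r⁻¹ x) ∈ G`, which solves the equation.
  let T : X × X → X × X := fun p => (p.1 + z, r⁻¹ • p.2)
  have hT : ∀ p q, ⟪(T p).2 - (T q).2, (T p).1 - (T q).1⟫_ℝ =
      r⁻¹ * ⟪p.2 - q.2, p.1 - q.1⟫_ℝ := fun p q => by
    simp [T, ← smul_sub, real_inner_smul_left]
  have hsurj : ∀ q, ∃ p, T p = q := fun q => ⟨(q.1 - z, r • q.2), by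
    simp [T, smul_smul, inv_mul_cancel₀ hr.ne']⟩
  have hmax : Maximal IsMonotoneGraph (T ⁻¹' G) := by
    refine ⟨fun p hp q hq => ?_, fun H hH hle p hp => ?_⟩
    · have := hG.prop _ hp _ hq
      rw [hT] at this
      exact nonneg_of_mul_nonneg_right this (inv_pos.2 hr)
    · refine mem_of_forall_monotone hG fun q hq => ?_
      obtain ⟨q, rfl⟩ := hsurj q
      rw [hT]
      exact mul_nonneg (inv_pos.2 hr).le (hH p hp q (hle hq))
  obtain ⟨x, hx⟩ := exists_mk_neg_mem hmax
  refine ⟨_, hx, ?_⟩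
  simp [T, smul_smul, mul_inv_cancel₀ hr.ne']

end Minty

/-! ### Resolvent iterates and the exponential formula -/

section Semigroup

variable {X : Type*} [NormedAddCommGroup X] [InnerProductSpace ℝ X]

/-- `I + r A` is onto for all `0 < r < R`. -/
def HasResolventsBelow (A : X →. X) (R : ℝ) : Prop :=
  ∀ r, 0 < r → r < R → ∀ z, ∃ y, ∃ v ∈ A y, y + r • v = z

theorem nlResolvent_spec {A : X →. X} {r : ℝ} {z : X} (h : ∃ y, ∃ v ∈ A y, y + r • v = z) :
    ∃ v ∈ A (nlResolvent A r z), nlResolvent A r z + r • v = z := by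
  rw [nlResolvent, dif_pos h]
  exact h.choose_spec

theorem nlResolvent_zero (A : X →. X) : nlResolvent A 0 = id := by
  funext x
  by_cases h : ∃ y, ∃ v ∈ A y, y + (0 : ℝ) • v = x
  · obtain ⟨v, -, h⟩ := nlResolvent_spec h
    simpa using h
  · rw [nlResolvent, dif_neg h, id]

theorem IsMonotoneGraph.norm_sub_le {A : X →. X} (hA : IsMonotoneGraph A.graph) {r : ℝ}
    (hr : 0 ≤ r) {y v z w : X} (hv : v ∈ A y) (hw : w ∈ A z) :
    ‖y - z‖ ≤ ‖(y + r • v) - (z + r • w)‖ := by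
  have h : 0 ≤ ⟪v - w, y - z⟫_ℝ := hA (y, v) hv (z, w) hw
  have e : (y + r • v) - (z + r • w) = (y - z) + r • (v - w) := by
    rw [smul_sub]
    abel
  rw [e]
  refine le_of_sq_le_sq ?_ (norm_nonneg _)
  rw [norm_add_sq_real, real_inner_smul_right, real_inner_comm]
  have := mul_nonneg hr h
  have := sq_nonneg ‖r • (v - w)‖
  linarith

variable {A : X →. X} {R : ℝ}

theorem norm_nlResolvent_sub_le (hA : IsMonotoneGraph A.graph) (hR : HasResolventsBelow A R)
    {r : ℝ} (hr : 0 < r) (hrR : r < R) (x y : X) :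
    ‖nlResolvent A r x - nlResolvent A r y‖ ≤ ‖x - y‖ := by
  obtain ⟨v, hv, hx⟩ := nlResolvent_spec (hR r hr hrR x)
  obtain ⟨w, hw, hy⟩ := nlResolvent_spec (hR r hr hrR y)
  simpa only [hx, hy] using hA.norm_sub_le hr.le hv hw

theorem norm_iterate_nlResolvent_sub_le (hA : IsMonotoneGraph A.graph)
    (hR : HasResolventsBelow A R) {r : ℝ} (hr : 0 < r) (hrR : r < R) (x y : X) (n : ℕ) :
    ‖(nlResolvent A r)^[n] x - (nlResolvent A r)^[n] y‖ ≤ ‖x - y‖ := by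
  induction n with
  | zero => rfl
  | succ n ih =>
    rw [Function.iterate_succ_apply', Function.iterate_succ_apply']
    exact (norm_nlResolvent_sub_le hA hR hr hrR _ _).trans ih

theorem norm_iterate_nlResolvent_sub_self_le (hA : IsMonotoneGraph A.graph)
    (hR : HasResolventsBelow A R) {r : ℝ} (hr : 0 < r) (hrR : r < R) {x v : X} (hv : v ∈ A x)
    (n : ℕ) : ‖(nlResolvent A r)^[n] x - x‖ ≤ n * r * ‖v‖ := by
  have h₁ : ‖nlResolvent A r x - x‖ ≤ r * ‖v‖ := by
    obtain ⟨w, hw, hx⟩ := nlResolvent_spec (hR r hr hrR x)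
    have := hA.norm_sub_le hr.le hw hv
    rwa [hx, sub_add_cancel_left, norm_neg, norm_smul, Real.norm_of_nonneg hr.le] at this
  induction n with
  | zero => simp
  | succ n ih =>
    rw [Function.iterate_succ_apply]
    calc ‖(nlResolvent A r)^[n] (nlResolvent A r x) - x‖
        ≤ ‖(nlResolvent A r)^[n] (nlResolvent A r x) - (nlResolvent A r)^[n] x‖
          + ‖(nlResolvent A r)^[n] x - x‖ := norm_sub_le_norm_sub_add_norm_sub _ _ _
      _ ≤ r * ‖v‖ + n * r * ‖v‖ :=
        add_le_add ((norm_iterate_nlResolvent_sub_le hA hR hr hrR _ _ n).trans h₁) ih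
      _ = (n + 1 : ℕ) * r * ‖v‖ := by push_cast; ring

/-- Expand both squares around the difference of the resolvents: the weights `s` and `r` merge the
cross terms into `2rs⟪v - w, a - b⟫ ≥ 0`. -/
theorem add_mul_norm_nlResolvent_sub_sq_le (hA : IsMonotoneGraph A.graph)
    (hR : HasResolventsBelow A R) {r s : ℝ} (hr : 0 < r) (hrR : r < R) (hs : 0 < s) (hsR : s < R)
    (x y : X) :
    (r + s) * ‖nlResolvent A r x - nlResolvent A s y‖ ^ 2 ≤
      s * ‖x - nlResolvent A s y‖ ^ 2 + r * ‖nlResolvent A r x - y‖ ^ 2 := by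
  obtain ⟨v, hv, hx⟩ := nlResolvent_spec (hR r hr hrR x)
  obtain ⟨w, hw, hy⟩ := nlResolvent_spec (hR s hs hsR y)
  set a := nlResolvent A r x
  set b := nlResolvent A s y
  have h : 0 ≤ ⟪v - w, a - b⟫_ℝ := hA (a, v) hv (b, w) hw
  have e₁ : x - b = (a - b) + r • v := by rw [← hx]; abel
  have e₂ : a - y = (a - b) - s • w := by rw [← hy]; abel
  rw [e₁, e₂, norm_add_sq_real (a - b), norm_sub_sq_real (a - b), real_inner_smul_right,
    real_inner_smul_right, real_inner_comm, real_inner_comm w]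
  rw [inner_sub_left] at h
  have h₁ := mul_nonneg (mul_pos hr hs).le h
  have h₂ := mul_nonneg hs.le (sq_nonneg ‖r • v‖)
  have h₃ := mul_nonneg hr.le (sq_nonneg ‖s • w‖)
  linarith

/-- Double induction: the right-hand side satisfies the recursion of the two-step inequality with
equality. For `i * r = j * s` only the small terms `i * r ^ 2 + j * s ^ 2` remain. -/
theorem norm_iterate_nlResolvent_sub_iterate_sq_le (hA : IsMonotoneGraph A.graph)
    (hR : HasResolventsBelow A R) {r s : ℝ} (hr : 0 < r) (hrR : r < R) (hs : 0 < s) (hsR : s < R)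
    {x v : X} (hv : v ∈ A x) (i j : ℕ) :
    ‖(nlResolvent A r)^[i] x - (nlResolvent A s)^[j] x‖ ^ 2 ≤
      ‖v‖ ^ 2 * ((i * r - j * s) ^ 2 + i * r ^ 2 + j * s ^ 2) := by
  induction i generalizing j with
  | zero =>
    have h := norm_iterate_nlResolvent_sub_self_le hA hR hs hsR hv j
    rw [norm_sub_rev] at h
    have h := pow_le_pow_left₀ (norm_nonneg _) h 2
    have h' : 0 ≤ ‖v‖ ^ 2 * (j * s ^ 2) := by positivity
    simp only [Function.iterate_zero, id, Nat.cast_zero]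
    linarith
  | succ i ihi =>
    induction j with
    | zero =>
      have h := norm_iterate_nlResolvent_sub_self_le hA hR hr hrR hv (i + 1)
      have h := pow_le_pow_left₀ (norm_nonneg _) h 2
      have h' : 0 ≤ ‖v‖ ^ 2 * ((i + 1 : ℕ) * r ^ 2) := by positivity
      simp only [Function.iterate_zero, id, Nat.cast_zero] at h h' ⊢
      linarith
    | succ j ihj =>
      have h := add_mul_norm_nlResolvent_sub_sq_le hA hR hr hrR hs hsR
        ((nlResolvent A r)^[i] x) ((nlResolvent A s)^[j] x)
      simp only [← Function.iterate_succ_apply'] at h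
      have h₁ := mul_le_mul_of_nonneg_left (ihi (j + 1)) hs.le
      have h₂ := mul_le_mul_of_nonneg_left ihj hr.le
      refine le_of_mul_le_mul_left ?_ (add_pos hr hs)
      refine h.trans ((add_le_add h₁ h₂).trans (le_of_eq ?_))
      push_cast
      ring

theorem eventually_div_lt (hR : 0 < R) (t : ℝ) : ∀ᶠ n : ℕ in atTop, 0 < n ∧ t / n < R :=
  (eventually_gt_atTop 0).and
    ((tendsto_const_div_atTop_nhds_zero_nat t).eventually_lt_const hR)

theorem cauchySeq_iterate_nlResolvent_of_mem (hA : IsMonotoneGraph A.graph) (hR₀ : 0 < R)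
    (hR : HasResolventsBelow A R) {t : ℝ} (ht : 0 < t) {x v : X} (hv : v ∈ A x) :
    CauchySeq fun n : ℕ => (nlResolvent A (t / n))^[n] x := by
  refine cauchySeq_of_norm_sq_le (e := fun n : ℕ => ‖v‖ ^ 2 * t ^ 2 / n)
    (tendsto_const_div_atTop_nhds_zero_nat _) ?_
  filter_upwards [eventually_forall_ge_atTop.2 (eventually_div_lt hR₀ t)] with N hN n hn m hm
  have hn₀ : (0 : ℝ) < n := Nat.cast_pos.2 (hN n hn).1
  have hm₀ : (0 : ℝ) < m := Nat.cast_pos.2 (hN m hm).1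
  refine (norm_iterate_nlResolvent_sub_iterate_sq_le hA hR (div_pos ht hn₀) (hN n hn).2
    (div_pos ht hm₀) (hN m hm).2 hv n m).trans (le_of_eq ?_)
  field_simp
  ring

theorem cauchySeq_iterate_nlResolvent (hA : IsMonotoneGraph A.graph) (hR₀ : 0 < R)
    (hR : HasResolventsBelow A R) {t : ℝ} (ht : 0 < t) {x : X} (hx : x ∈ closure A.Dom) :
    CauchySeq fun n : ℕ => (nlResolvent A (t / n))^[n] x := by
  rw [Metric.cauchySeq_iff]
  intro ε hε
  obtain ⟨y, hy, hxy⟩ := Metric.mem_closure_iff.1 hx (ε / 3) (by positivity)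
  obtain ⟨v, hv⟩ := (PFun.mem_dom _ _).1 hy
  obtain ⟨N, hN⟩ := Metric.cauchySeq_iff.1
    (cauchySeq_iterate_nlResolvent_of_mem hA hR₀ hR ht hv) (ε / 3) (by positivity)
  obtain ⟨N', hN'⟩ := eventually_atTop.1 (eventually_div_lt hR₀ t)
  have hle : ∀ n ≥ N', dist ((nlResolvent A (t / n))^[n] x) ((nlResolvent A (t / n))^[n] y) <
      ε / 3 := fun n hn => by
    refine lt_of_le_of_lt ?_ hxy
    rw [dist_eq_norm, dist_eq_norm]
    exact norm_iterate_nlResolvent_sub_le hA hR (div_pos ht (Nat.cast_pos.2 (hN' n hn).1))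
      (hN' n hn).2 x y n
  refine ⟨max N N', fun m hm n hn => ?_⟩
  have h₁ := hle m ((le_max_right _ _).trans hm)
  have h₂ := hle n ((le_max_right _ _).trans hn)
  have h₃ := hN m ((le_max_left _ _).trans hm) n ((le_max_left _ _).trans hn)
  rw [dist_comm] at h₂
  refine (dist_triangle4 _ _ _ _).trans_lt ((add_lt_add (add_lt_add h₁ h₃) h₂).trans_eq ?_)
  ring

theorem exists_isGeneratedBy [CompleteSpace X] (hA : IsMonotoneGraph A.graph) (hR₀ : 0 < R)
    (hR : HasResolventsBelow A R) : ∃ S, IsGeneratedBy S A := by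
  refine ⟨fun t x => limUnder atTop fun n : ℕ => (nlResolvent A (t / n))^[n] x,
    fun x hx t ht => ?_⟩
  rcases ht.eq_or_lt with rfl | ht
  · simp only [zero_div, nlResolvent_zero, Function.iterate_id, id]
    exact tendsto_nhds_limUnder ⟨x, tendsto_const_nhds⟩
  · exact tendsto_nhds_limUnder (cauchySeq_tendsto_of_complete
      (cauchySeq_iterate_nlResolvent hA hR₀ hR ht hx))

theorem IsGeneratedBy.apply_zero {S : ℝ → X → X} (hS : IsGeneratedBy S A) {x : X}
    (hx : x ∈ closure A.Dom) : S 0 x = x := by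
  have := hS x hx 0 le_rfl
  simp only [zero_div, nlResolvent_zero, Function.iterate_id, id] at this
  exact tendsto_nhds_unique this tendsto_const_nhds

/-- Compare `k` steps of size `r` with `m` steps of size `k * r / m` and let `m → ∞`. -/
theorem IsGeneratedBy.norm_iterate_sub_sq_le {S : ℝ → X → X} (hS : IsGeneratedBy S A)
    (hA : IsMonotoneGraph A.graph) (hR : HasResolventsBelow A R) {r : ℝ} (hr : 0 < r)
    (hrR : r < R) {x v : X} (hv : v ∈ A x) (k : ℕ) :
    ‖(nlResolvent A r)^[k] x - S (k * r) x‖ ^ 2 ≤ ‖v‖ ^ 2 * (k * r ^ 2) := by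
  have hx : x ∈ closure A.Dom := subset_closure ((PFun.mem_dom _ _).2 ⟨v, hv⟩)
  rcases k.eq_zero_or_pos with rfl | hk
  · simp [hS.apply_zero hx]
  have hk₀ : (0 : ℝ) < k := Nat.cast_pos.2 hk
  have ht : 0 < k * r := mul_pos hk₀ hr
  have h₁ := ((hS x hx (k * r) ht.le).const_sub ((nlResolvent A r)^[k] x)).norm.pow 2
  have h₂ : Tendsto (fun m : ℕ => ‖v‖ ^ 2 * (k * r ^ 2 + (k * r) ^ 2 / m)) atTop
      (𝓝 (‖v‖ ^ 2 * (k * r ^ 2 + 0))) :=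
    ((tendsto_const_div_atTop_nhds_zero_nat _).const_add _).const_mul _
  rw [add_zero] at h₂
  refine le_of_tendsto_of_tendsto h₁ h₂ ?_
  filter_upwards [eventually_div_lt (hr.trans hrR) (k * r)] with m hm
  have hm₀ : (0 : ℝ) < m := Nat.cast_pos.2 hm.1
  refine (norm_iterate_nlResolvent_sub_iterate_sq_le hA hR hr hrR (div_pos ht hm₀) hm.2 hv
    k m).trans (le_of_eq ?_)
  field_simp
  ring

end Semigroup

/-! ### Monotone Lipschitz perturbations -/

section Perturbation

theorem mem_addMap {X : Type*} [NormedAddCommGroup X] {M : X →. X} {K : X → X}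
    {x v : X} :
    v ∈ addMap M K x ↔ ∃ w ∈ M x, w + K x = v :=
  Part.mem_map_iff _

theorem dom_addMap {X : Type*} [NormedAddCommGroup X] (M : X →. X) (K : X → X) :
    (addMap M K).Dom = M.Dom := rfl

theorem addMap_addMap {X : Type*} [NormedAddCommGroup X] (M : X →. X) (K L : X → X) :
    addMap (addMap M K) L = addMap M fun x => K x + L x := by
  funext x
  ext v
  simp [mem_addMap, add_assoc]

variable {X : Type*} [NormedAddCommGroup X] [InnerProductSpace ℝ X]

theorem isMonotoneGraph_addMap {M : X →. X} (hM : IsMonotoneGraph M.graph) {K : X → X}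
    (hK : ∀ x z, 0 ≤ ⟪K x - K z, x - z⟫_ℝ) : IsMonotoneGraph (addMap M K).graph := by
  rintro ⟨x, v'⟩ hv' ⟨z, w'⟩ hw'
  obtain ⟨v, hv, rfl⟩ : ∃ v ∈ M x, v + K x = v' := mem_addMap.1 hv'
  obtain ⟨w, hw, rfl⟩ : ∃ w ∈ M z, w + K z = w' := mem_addMap.1 hw'
  have h : 0 ≤ ⟪v - w, x - z⟫_ℝ := hM (x, v) hv (z, w) hw
  simp only [add_sub_add_comm, inner_add_left]
  exact add_nonneg h (hK x z)

/-- The resolvent equation is the fixed-point problem `y = (I + r M)⁻¹ (z - r K y)`, a contraction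
once `r L < 1`. -/
theorem exists_hasResolventsBelow_addMap [CompleteSpace X] {M : X →. X}
    (hM : IsMaximalMonotone M) {K : X → X} {L : NNReal} (hK : LipschitzWith L K) :
    ∃ R > 0, HasResolventsBelow (addMap M K) R := by
  refine ⟨1 / (L + 1), by positivity, fun r hr hrR z => ?_⟩
  have hM' : ∀ z, ∃ y, ∃ v ∈ M y, y + r • v = z := fun z => by
    obtain ⟨p, hp, h⟩ := exists_add_smul_eq hM hr z
    exact ⟨p.1, p.2, hp, h⟩
  have hrL : r * L < 1 := by
    rw [lt_div_iff₀ (by positivity)] at hrR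
    linarith
  let T : X → X := fun y => nlResolvent M r (z - r • K y)
  have hT : ContractingWith (Real.toNNReal (r * L)) T := by
    refine ⟨by rwa [Real.toNNReal_lt_one], LipschitzWith.of_dist_le_mul fun x y => ?_⟩
    obtain ⟨v, hv, hx⟩ := nlResolvent_spec (hM' (z - r • K x))
    obtain ⟨w, hw, hy⟩ := nlResolvent_spec (hM' (z - r • K y))
    have h := hM.prop.norm_sub_le hr.le hv hw
    rw [hx, hy, sub_sub_sub_cancel_left, ← smul_sub, norm_smul, Real.norm_of_nonneg hr.le,
      ← dist_eq_norm, ← dist_eq_norm, dist_comm (K y)] at h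
    rw [Real.coe_toNNReal _ (by positivity), mul_assoc]
    exact h.trans (mul_le_mul_of_nonneg_left (hK.dist_le_mul x y) hr.le)
  have : Nonempty X := ⟨0⟩
  have hfix : T (hT.fixedPoint T) = hT.fixedPoint T := hT.fixedPoint_isFixedPt
  obtain ⟨v, hv, h⟩ := nlResolvent_spec (hM' (z - r • K (hT.fixedPoint T)))
  change v ∈ M (T (hT.fixedPoint T)) at hv
  change T (hT.fixedPoint T) + r • v = _ at h
  rw [hfix] at hv h
  refine ⟨_, _, mem_addMap.2 ⟨v, hv, rfl⟩, ?_⟩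
  rw [smul_add, ← add_assoc, h, sub_add_cancel]

/-- A step of the first scheme is a step of the second with its input shifted by `r (K₂ - K₁)`,
taken at the new iterate. Nonexpansiveness makes these errors merely add up. -/
theorem norm_iterate_nlResolvent_addMap_sub_le {M : X →. X} {K₁ K₂ : X → X} {R₁ R₂ r : ℝ}
    (hR₁ : HasResolventsBelow (addMap M K₁) R₁) (hA₂ : IsMonotoneGraph (addMap M K₂).graph)
    (hR₂ : HasResolventsBelow (addMap M K₂) R₂) (hr : 0 < r) (hr₁ : r < R₁) (hr₂ : r < R₂)
    {x : X} {ε : ℝ} (n : ℕ)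
    (h : ∀ k ≤ n, ‖K₂ ((nlResolvent (addMap M K₁) r)^[k] x) -
      K₁ ((nlResolvent (addMap M K₁) r)^[k] x)‖ ≤ ε) :
    ‖(nlResolvent (addMap M K₁) r)^[n] x - (nlResolvent (addMap M K₂) r)^[n] x‖ ≤
      n * (r * ε) := by
  induction n with
  | zero => simp
  | succ n ih =>
    specialize ih fun k hk => h k (hk.trans n.le_succ)
    have hε := h (n + 1) le_rfl
    rw [Function.iterate_succ_apply'] at hε
    rw [Function.iterate_succ_apply', Function.iterate_succ_apply']
    set y := (nlResolvent (addMap M K₁) r)^[n] x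
    set z := (nlResolvent (addMap M K₂) r)^[n] x
    obtain ⟨v, hv, hy⟩ := nlResolvent_spec (hR₁ r hr hr₁ y)
    obtain ⟨w, hw, hz⟩ := nlResolvent_spec (hR₂ r hr hr₂ z)
    set a := nlResolvent (addMap M K₁) r y
    set b := nlResolvent (addMap M K₂) r z
    obtain ⟨v, hvM, rfl⟩ := mem_addMap.1 hv
    have hv' : v + K₂ a ∈ addMap M K₂ a := mem_addMap.2 ⟨v, hvM, rfl⟩
    have key := hA₂.norm_sub_le hr.le hv' hw
    have e : a + r • (v + K₂ a) - (b + r • w) = (y - z) + r • (K₂ a - K₁ a) := by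
      rw [hz, ← hy, smul_add, smul_add, smul_sub]
      abel
    rw [e] at key
    calc ‖a - b‖ ≤ ‖y - z‖ + ‖r • (K₂ a - K₁ a)‖ := key.trans (norm_add_le _ _)
      _ ≤ n * (r * ε) + r * ε := by
        rw [norm_smul, Real.norm_of_nonneg hr.le]
        exact add_le_add ih (mul_le_mul_of_nonneg_left hε hr.le)
      _ = (n + 1 : ℕ) * (r * ε) := by push_cast; ring

/-- If two Lipschitz-close perturbations of `M` agree along a trajectory of the first perturbed
system, then this is also a trajectory of the second one. -/
theorem IsGeneratedBy.eq_of_eq_along {M : X →. X} {K₁ K₂ : X → X} {R₁ R₂ : ℝ} {L : NNReal}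
    (hA₁ : IsMonotoneGraph (addMap M K₁).graph) (hR₁₀ : 0 < R₁)
    (hR₁ : HasResolventsBelow (addMap M K₁) R₁)
    (hA₂ : IsMonotoneGraph (addMap M K₂).graph) (hR₂₀ : 0 < R₂)
    (hR₂ : HasResolventsBelow (addMap M K₂) R₂)
    (hL : LipschitzWith L fun x => K₂ x - K₁ x)
    {S₁ S₂ : ℝ → X → X} (hS₁ : IsGeneratedBy S₁ (addMap M K₁))
    (hS₂ : IsGeneratedBy S₂ (addMap M K₂)) {x : X} (hx : x ∈ M.Dom)
    (h : ∀ t ≥ 0, K₂ (S₁ t x) = K₁ (S₁ t x)) {t : ℝ} (ht : 0 ≤ t) : S₁ t x = S₂ t x := by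
  have hx₁ : x ∈ closure (addMap M K₁).Dom := subset_closure hx
  have hx₂ : x ∈ closure (addMap M K₂).Dom := subset_closure hx
  rcases ht.eq_or_lt with rfl | ht
  · rw [hS₁.apply_zero hx₁, hS₂.apply_zero hx₂]
  obtain ⟨v, hv⟩ := (PFun.mem_dom _ _).1 (show x ∈ (addMap M K₁).Dom from hx)
  rw [← sub_eq_zero, ← norm_eq_zero]
  refine tendsto_nhds_unique ((hS₁ x hx₁ t ht.le).sub (hS₂ x hx₂ t ht.le)).norm ?_
  have hlim : Tendsto (fun n : ℕ => t ^ 2 * L * ‖v‖ / √(n : ℝ)) atTop (𝓝 0) :=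
    (Real.tendsto_sqrt_atTop.comp tendsto_natCast_atTop_atTop).const_div_atTop _
  refine squeeze_zero' (Eventually.of_forall fun _ => norm_nonneg _) ?_ hlim
  filter_upwards [eventually_div_lt hR₁₀ t, eventually_div_lt hR₂₀ t] with n hn₁ hn₂
  have hn₀ : (0 : ℝ) < n := Nat.cast_pos.2 hn₁.1
  have hr : 0 < t / n := div_pos ht hn₀
  -- `ε` is `L` times the distance bound from iterate to flow, where `K₂ - K₁` vanishes; `k ≤ n`
  -- makes it uniform in `k`.
  refine (norm_iterate_nlResolvent_addMap_sub_le (ε := L * (‖v‖ * (√(n : ℝ) * (t / n))))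
    hR₁ hA₂ hR₂ hr hn₁.2 hn₂.2 n fun k hk => ?_).trans (le_of_eq ?_)
  · have h₁ := hL.norm_sub_le ((nlResolvent (addMap M K₁) (t / n))^[k] x) (S₁ (k * (t / n)) x)
    rw [h _ (by positivity), sub_self, sub_zero] at h₁
    refine h₁.trans (mul_le_mul_of_nonneg_left ?_ L.2)
    refine le_of_sq_le_sq ?_ (by positivity)
    refine (hS₁.norm_iterate_sub_sq_le hA₁ hR₁ hr hn₁.2 hv k).trans ?_
    rw [mul_pow, mul_pow, Real.sq_sqrt hn₀.le]
    have : (k : ℝ) ≤ n := Nat.cast_le.2 hk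
    gcongr
  · have h₁ : √(n : ℝ) ≠ 0 := (Real.sqrt_pos.2 hn₀).ne'
    have h₂ : √(n : ℝ) ^ 2 = n := Real.sq_sqrt hn₀.le
    field_simp
    rw [h₂]
    ring

end Perturbation

/-! ### The metric projection -/

section Projection

variable {U : Type*} [NormedAddCommGroup U] [InnerProductSpace ℝ U] [CompleteSpace U] {F : Set U}

theorem inner_sub_proj_le_zero (hne : F.Nonempty) (hcl : IsClosed F) (hc : Convex ℝ F) (u : U)
    {q : U} (hq : q ∈ F) : ⟪u - proj F u, q - proj F u⟫_ℝ ≤ 0 := by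
  obtain ⟨hmem, hle⟩ := proj_spec hne hcl hc u
  refine (norm_eq_iInf_iff_real_inner_le_zero hc hmem).1 (le_antisymm ?_ ?_) q hq
  · have : Nonempty F := hne.to_subtype
    exact le_ciInf fun w => hle w w.2
  · exact ciInf_le ⟨0, by rintro _ ⟨w, rfl⟩; exact norm_nonneg _⟩ (⟨_, hmem⟩ : F)

/-- Firm nonexpansiveness: add the variational inequalities at `u` and `v`, each tested with the
other's projection. It yields both the Lipschitz bound and the monotonicity of the feedback. -/
theorem norm_proj_sub_proj_sq_le (hne : F.Nonempty) (hcl : IsClosed F) (hc : Convex ℝ F)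
    (u v : U) : ‖proj F u - proj F v‖ ^ 2 ≤ ⟪proj F u - proj F v, u - v⟫_ℝ := by
  have h₁ := inner_sub_proj_le_zero hne hcl hc u (proj_spec hne hcl hc v).1
  have h₂ := inner_sub_proj_le_zero hne hcl hc v (proj_spec hne hcl hc u).1
  rw [← real_inner_self_eq_norm_sq]
  simp only [inner_sub_left, inner_sub_right] at h₁ h₂ ⊢
  rw [real_inner_comm u (proj F u), real_inner_comm u (proj F v), real_inner_comm v (proj F v),
    real_inner_comm v (proj F u)]
  rw [real_inner_comm (proj F v) (proj F u)] at *
  linarith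

theorem lipschitzWith_proj (hne : F.Nonempty) (hcl : IsClosed F) (hc : Convex ℝ F) :
    LipschitzWith 1 (proj F) := by
  refine LipschitzWith.of_dist_le_mul fun u v => ?_
  rw [NNReal.coe_one, one_mul, dist_eq_norm, dist_eq_norm]
  have h := (norm_proj_sub_proj_sq_le hne hcl hc u v).trans (real_inner_le_norm _ _)
  rw [sq] at h
  rcases (norm_nonneg (proj F u - proj F v)).eq_or_lt with h0 | h0
  · rw [← h0]
    exact norm_nonneg _
  · exact le_of_mul_le_mul_left h h0

theorem proj_eq_self (hcl : IsClosed F) (hc : Convex ℝ F) {u : U} (hu : u ∈ F) :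
    proj F u = u := by
  have := (proj_spec ⟨u, hu⟩ hcl hc u).2 u hu
  rw [sub_self, norm_zero, norm_le_zero_iff, sub_eq_zero] at this
  exact this.symm

end Projection

/-! ### Transfer of detectability -/

section Detectability

variable {X U : Type*}
  [NormedAddCommGroup X] [InnerProductSpace ℝ X] [CompleteSpace X]
  [NormedAddCommGroup U] [InnerProductSpace ℝ U] [CompleteSpace U]

theorem mem_unobservableSet {D : Set X} {S : ℝ → X → X} {B : U →L[ℝ] X} {x x₀ : X} :
    x₀ ∈ unobservableSet D S B x ↔ x₀ ∈ D ∧ ∀ t ≥ 0,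
      ContinuousLinearMap.adjoint B (S t x₀) = ContinuousLinearMap.adjoint B x := by
  simp only [unobservableSet, mem_iInter, unobservableOn, mem_ofPred_eq, mem_Ici, mem_Icc]
  exact ⟨fun h => ⟨(h 0 le_rfl).1, fun t ht => (h t ht).2 t ⟨ht, le_rfl⟩⟩,
    fun h t _ => ⟨h.1, fun s hs => h.2 s hs.1⟩⟩

/-- Detectability passes from one Lipschitz perturbation of `M` to another one if they agree
at all states with the output of the equilibrium. -/
theorem exists_isGeneratedBy_tendsto_of_exists {M : X →. X} (hM : IsMaximalMonotone M)
    {B : U →L[ℝ] X} {x : X} {K₁ K₂ : X → X} {L₁ L₂ : NNReal} (hL₁ : LipschitzWith L₁ K₁)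
    (hL₂ : LipschitzWith L₂ K₂) (hK₁ : ∀ y z, 0 ≤ ⟪K₁ y - K₁ z, y - z⟫_ℝ)
    (hK₂ : ∀ y z, 0 ≤ ⟪K₂ y - K₂ z, y - z⟫_ℝ)
    (hK : ∀ y, ContinuousLinearMap.adjoint B y = ContinuousLinearMap.adjoint B x → K₁ y = K₂ y)
    (h : ∃ S : ℝ → X → X, IsGeneratedBy S (addMap M K₁) ∧
      ∀ x₀ ∈ unobservableSet M.Dom S B x, Tendsto (fun t => S t x₀) atTop (𝓝 x)) :
    ∃ S : ℝ → X → X, IsGeneratedBy S (addMap M K₂) ∧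
      ∀ x₀ ∈ unobservableSet M.Dom S B x, Tendsto (fun t => S t x₀) atTop (𝓝 x) := by
  obtain ⟨S₁, hS₁, hdet⟩ := h
  have hA₁ := isMonotoneGraph_addMap hM.prop hK₁
  have hA₂ := isMonotoneGraph_addMap hM.prop hK₂
  obtain ⟨R₁, hR₁₀, hR₁⟩ := exists_hasResolventsBelow_addMap hM hL₁
  obtain ⟨R₂, hR₂₀, hR₂⟩ := exists_hasResolventsBelow_addMap hM hL₂
  obtain ⟨S₂, hS₂⟩ := exists_isGeneratedBy hA₂ hR₂₀ hR₂
  refine ⟨S₂, hS₂, fun x₀ hx₀ => ?_⟩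
  obtain ⟨hD, hobs⟩ := mem_unobservableSet.1 hx₀
  have heq : ∀ t ≥ 0, S₂ t x₀ = S₁ t x₀ := fun t ht =>
    -- The new flow `S₂` takes the role of the first system, since it is along `S₂` that the output
    -- is known to be constant.
    IsGeneratedBy.eq_of_eq_along hA₂ hR₂₀ hR₂ hA₁ hR₁₀ hR₁ (hL₁.sub hL₂) hS₂ hS₁ hD
      (fun s hs => hK _ (hobs s hs)) ht
  refine (hdet x₀ (mem_unobservableSet.2 ⟨hD, fun t ht => ?_⟩)).congr' ?_
  · rw [← heq t ht, hobs t ht]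
  · filter_upwards [eventually_ge_atTop 0] with t ht using (heq t ht).symm

variable (B : U →L[ℝ] X) {F : Set U} (x : X) (u : U)

theorem lipschitzWith_feedback (hne : F.Nonempty) (hcl : IsClosed F) (hc : Convex ℝ F) :
    ∃ L, LipschitzWith L
      fun y => -B (proj F (u - ContinuousLinearMap.adjoint B (y - x))) := by
  have h₁ : LipschitzWith _ fun y => u - ContinuousLinearMap.adjoint B (y - x) :=
    (LipschitzWith.const u).sub
      ((ContinuousLinearMap.adjoint B).lipschitz.comp (LipschitzWith.id.sub (LipschitzWith.const x)))
  exact ⟨_, (B.lipschitz.comp ((lipschitzWith_proj hne hcl hc).comp h₁)).neg⟩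

/-- Moving `B` across the inner product turns this into monotonicity of `proj F`; the minus signs
before `B` and before its adjoint cancel. -/
theorem inner_feedback_nonneg (hne : F.Nonempty) (hcl : IsClosed F) (hc : Convex ℝ F) (y z : X) :
    0 ≤ ⟪-B (proj F (u - ContinuousLinearMap.adjoint B (y - x))) -
      -B (proj F (u - ContinuousLinearMap.adjoint B (z - x))), y - z⟫_ℝ := by
  have h := norm_proj_sub_proj_sq_le hne hcl hc (u - ContinuousLinearMap.adjoint B (y - x))
    (u - ContinuousLinearMap.adjoint B (z - x))
  have e : u - ContinuousLinearMap.adjoint B (y - x) - (u - ContinuousLinearMap.adjoint B (z - x))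
      = -ContinuousLinearMap.adjoint B (y - z) := by
    simp only [map_sub]
    abel
  rw [e, inner_neg_right, ContinuousLinearMap.adjoint_inner_right, map_sub B] at h
  rw [← neg_sub', inner_neg_left]
  exact (sq_nonneg _).trans h

end Detectability

end MonotoneControl

theorem proposition3p12
    {X U : Type*}
    [NormedAddCommGroup X] [InnerProductSpace ℝ X] [CompleteSpace X]
    [NormedAddCommGroup U] [InnerProductSpace ℝ U] [CompleteSpace U]
    (M : X →. X) (hM : MonotoneControl.IsMaximalMonotone M)
    (B : U →L[ℝ] X)
    (F : Set U) (hFclosed : IsClosed F) (hFconvex : Convex ℝ F)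
    (xs : X) (us : U) (hus : us ∈ interior F)
    (heq : MonotoneControl.IsControlledEquilibrium M B xs us) :
    MonotoneControl.IsDetectableAt M B xs us ↔
      MonotoneControl.IsDetectableAt (MonotoneControl.closedLoop M B F xs us) B xs 0 := by
  have husF : us ∈ F := interior_subset hus
  obtain ⟨L, hL⟩ := MonotoneControl.lipschitzWith_feedback B xs us ⟨us, husF⟩ hFclosed hFconvex
  have hmono := MonotoneControl.inner_feedback_nonneg B xs us ⟨us, husF⟩ hFclosed hFconvex
  have hK : ∀ y, ContinuousLinearMap.adjoint B y = ContinuousLinearMap.adjoint B xs →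
      -B us = -B (MonotoneControl.proj F (us - ContinuousLinearMap.adjoint B (y - xs))) := fun y hy => by
    rw [map_sub, hy, sub_self, sub_zero, MonotoneControl.proj_eq_self hFclosed hFconvex husF]
  have hconst : ∀ y z : X, 0 ≤ ⟪-B us - -B us, y - z⟫_ℝ := fun y z => by simp
  rw [MonotoneControl.IsDetectableAt, MonotoneControl.IsDetectableAt, MonotoneControl.closedLoop,
    MonotoneControl.addMap_addMap, MonotoneControl.dom_addMap]
  simp only [map_zero, neg_zero, add_zero]
  exact ⟨MonotoneControl.exists_isGeneratedBy_tendsto_of_exists hM (LipschitzWith.const _) hL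
      hconst hmono hK,
    MonotoneControl.exists_isGeneratedBy_tendsto_of_exists hM hL (LipschitzWith.const _)
      hmono hconst fun y hy => (hK y hy).symm⟩
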